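/- Let $\mathbf C$ be a category with finite coproducts and $\mathbf D$ any category. **Conventions.** For a monad $T$ on $\mathbf C$ write $\eta$ for its unit and $f^\star\colon TX\to TY$ for the Kleisli lifting of $f\colon X\to TY$. A (total) iteration operator on $T$ assigns to every $f\colon X\to T(Y+X)$ a morphism $f^\dagger\colon X\to TY$. The monad $T$ equipped with $(-)^\dagger$ is a (complete) *Elgot monad* if the following hold: - fixpoint: $f^\dagger=[\eta,f^\dagger]^\star f$ for $f\colon X\to T(Y+X)$; - naturality: $g^\star f^\dagger=([(T\,\mathrm{inl})\,g,\ \eta\,\mathrm{inr}]^\star f)^\dagger$ for $f\colon X\to T(Y+X)$, $g\colon Y\to TZ$; - codiagonal: $(T[\mathrm{id},\mathrm{inr}]\,f)^\dagger=f^{\dagger\dagger}$ for $f\colon X\to T((Y+X)+X)$; - uniformity: $f h=T(\mathrm{id}+h)\,g$ implies $f^\dagger h=g^\dagger$ for $f\colon X\to T(Y+X)$, $g\colon Z\to T(Y+Z)$, $h\colon Z\to X$. A *parametrized monad* with parameters in a category $\mathbf B$ is a functor from $\mathbf B$ to the category of monads on $\mathbf C$, written as a bifunctor $\#\colon\mathbf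 C\times\mathbf B\to\mathbf C$, with $b\in|\mathbf B|$ sent to the monad $(-)\#b$. It is *Elgot* if every monad $(-)\#b$ is equipped with an iteration operator that makes it an Elgot monad, and for every $p\colon b\to b'$ the monad morphism $(-)\#p$ preserves iteration, i.e. $(\mathrm{id}\#p)\,f^\dagger=((\mathrm{id}\#p)\,f)^\dagger$. **The monad $\#^\nu_X$.** Let $\#\colon\mathbf C\times(\mathbf C\times\mathbf D)\to\mathbf C$ be a parametrized monad and $X\in|\mathbf D|$, and suppose that for every $Y\in|\mathbf C|$ a final coalgebra $\mathrm{out}\colon \#^\nu_X Y\to Y\#(\#^\nu_XY,X)$ of the endofunctor $\gamma\mapsto Y\#(\gamma,X)$ exists, so that $\#^\nu_XY=\nu\gamma.\,Y\#(\gamma,X)$; write $\mathrm{coit}\,c$ for the unique coalgebra morphism from $c$ to $\mathrm{out}$. Then $\#^\nu_X$ is a monad on $\mathbf C$ whose unit $\eta^\nu$ is determined by $\mathrm{out}\,\eta^\nu=\eta$ and whose Kleisli lifting $f^{\ast}\colon\#^\nu_XZ\to\#^\nu_XY$ of $f\colon Z\to\#^\nu_XY$ is given by $[f^{\ast},\mathrm{id}]=\mathrm{coit}\big[\bar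 f^\star\,(\mathrm{id}\#(\mathrm{inl},\mathrm{id}))\,\mathrm{out},\ (\mathrm{id}\#(\mathrm{inr},\mathrm{id}))\,\mathrm{out}\big]$ with $\bar f=(\mathrm{id}\#(\mathrm{inr},\mathrm{id}))\,\mathrm{out}\,f$. **Claim.** 1. If, for fixed $X$, the parametrized monad $\gamma\mapsto(-)\#(\gamma,X)$ (with parameters in $\mathbf C$) is Elgot with iteration operators $(-)^\dagger$, then the monad $\#^\nu_X=\nu\gamma.\,(-)\#(\gamma,X)$ is an Elgot monad, with the iteration operator that sends $f\colon Z\to\#^\nu_X(Y+Z)$ to $$\mathrm{coit}\big([\eta,(\mathrm{out}\,f)^\dagger]^\star\,\mathrm{out}\big)\;\eta^\nu\,\mathrm{inr}\colon\ Z\to\#^\nu_XY .$$ 2. In particular, the generalized coalgebraic resumption transform preserves Elgotness: if $T$ is an Elgot monad on $\mathbf C$ with iteration operator $(-)^\dagger$, $\Sigma$ is an endofunctor of $\mathbf C$, and the final coalgebras $T_\Sigma Y=\nu\gamma.\,T(Y+\Sigma\gamma)$ exist for all $Y\in|\mathbf C|$, then the monad $T_\Sigma$ (obtained by the construction above from $Y\#\gamma=T(Y+\Sigma\gamma)$)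 is an Elgot monad, with the iteration operator that sends $f\colon Z\to T_\Sigma(Y+Z)$ to $$\mathrm{coit}\big(\big[[\eta\,\mathrm{inl},\,(T[\mathrm{inl}+\mathrm{id},\,\mathrm{inl}\,\mathrm{inr}]\,\mathrm{out}\,f)^\dagger],\ \eta\,\mathrm{inr}\big]^\star\,\mathrm{out}\big)\;\eta^\nu\,\mathrm{inr}\colon\ Z\to T_\Sigma Y ,$$ where $\eta$ and $(-)^\star$ are those of $T$. -/

import Mathlib

open CategoryTheory CategoryTheory.Limits

universe v u v' u'

namespace GuardedIteration

section Kleisli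

variable {C : Type u} [Category.{v} C]

/-- Kleisli lifting: `f : X ⟶ T Y` is sent to `T X ⟶ T Y`. -/
def klift (T : Monad C) {X Y : C} (f : X ⟶ T.obj Y) : T.obj X ⟶ T.obj Y :=
  T.map f ≫ T.μ.app Y

theorem klift_unit (T : Monad C) (X : C) : klift T (T.η.app X) = 𝟙 (T.obj X) := by
  simp [klift]

theorem unit_klift (T : Monad C) {X Y : C} (f : X ⟶ T.obj Y) :
    T.η.app X ≫ klift T f = f := by
  have h := T.η.naturality f
  simp only [Functor.id_map] at h
  rw [klift, ← Category.assoc, ← h, Category.assoc, T.left_unit, Category.comp_id]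

theorem klift_klift (T : Monad C) {X Y Z : C} (f : X ⟶ T.obj Y) (g : Y ⟶ T.obj Z) :
    klift T f ≫ klift T g = klift T (f ≫ klift T g) := by
  simp only [klift, Functor.map_comp, Category.assoc]
  rw [← Monad.mu_naturality_assoc, T.assoc]

theorem map_eq_klift (T : Monad C) {X Y : C} (f : X ⟶ Y) :
    T.map f = klift T (f ≫ T.η.app Y) := by
  simp [klift]

theorem klift_monadHom {S T : Monad C} (α : S ⟶ T) {X Y : C} (f : X ⟶ S.obj Y) :
    klift S f ≫ α.app Y = α.app X ≫ klift T (f ≫ α.app Y) := by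
  simp [klift]

/-- The monad given by a Kleisli triple. -/
def monadOfKleisli (T : C → C) (unit : ∀ X, X ⟶ T X)
    (lift : ∀ {X Y : C}, (X ⟶ T Y) → (T X ⟶ T Y))
    (lift_unit : ∀ X, lift (unit X) = 𝟙 (T X))
    (unit_lift : ∀ {X Y : C} (f : X ⟶ T Y), unit X ≫ lift f = f)
    (lift_lift : ∀ {X Y Z : C} (f : X ⟶ T Y) (g : Y ⟶ T Z),
      lift f ≫ lift g = lift (f ≫ lift g)) : Monad C where
  obj := T
  map f := lift (f ≫ unit _)
  map_id X := by simp [lift_unit]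
  map_comp f g := by simp [lift_lift, unit_lift]
  η := { app := unit, naturality := fun X Y f => by simp [unit_lift] }
  μ := { app := fun X => lift (𝟙 (T X)), naturality := fun X Y f => by
          simp [lift_lift, unit_lift] }
  assoc X := by simp [lift_lift, unit_lift]
  left_unit X := by simp [unit_lift]
  right_unit X := by simp [lift_lift, unit_lift, lift_unit]

theorem klift_monadOfKleisli (T : C → C) (unit : ∀ X, X ⟶ T X)
    (lift : ∀ {X Y : C}, (X ⟶ T Y) → (T X ⟶ T Y))
    (lift_unit : ∀ X, lift (unit X) = 𝟙 (T X))
    (unit_lift : ∀ {X Y : C} (f : X ⟶ T Y), unit X ≫ lift f = f)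
    (lift_lift : ∀ {X Y Z : C} (f : X ⟶ T Y) (g : Y ⟶ T Z),
      lift f ≫ lift g = lift (f ≫ lift g)) {X Y : C} (f : X ⟶ T Y) :
    klift (monadOfKleisli T unit lift lift_unit unit_lift lift_lift) (Y := Y) f = lift f := by
  change lift (f ≫ unit _) ≫ lift (𝟙 (T Y)) = lift f
  rw [lift_lift, Category.assoc, unit_lift, Category.comp_id]

/-- A family of morphisms compatible with units and Kleisli lifting is a monad morphism. -/
def monadHomOfKleisli {S T : Monad C} (α : ∀ X, S.obj X ⟶ T.obj X)
    (α_unit : ∀ X, S.η.app X ≫ α X = T.η.app X)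
    (α_lift : ∀ {X Y : C} (f : X ⟶ S.obj Y),
      klift S f ≫ α Y = α X ≫ klift T (f ≫ α Y)) : S ⟶ T :=
  MonadHom.mk
    { app := α
      naturality := fun X Y f => by
        rw [map_eq_klift S, map_eq_klift T, α_lift, Category.assoc, α_unit] }
    α_unit
    (fun X => by
      have h := α_lift (𝟙 (S.obj X))
      have e : klift S (𝟙 (S.obj X)) = S.μ.app X := by simp [klift]
      have n : S.map (α X) ≫ α (T.obj X) = α (S.obj X) ≫ T.map (α X) := by
        rw [map_eq_klift S, map_eq_klift T, α_lift, Category.assoc, α_unit]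
      rw [e, Category.id_comp] at h
      simp only [n]
      rw [h, klift, Category.assoc])

end Kleisli

section Elgot

variable {C : Type u} [Category.{v} C] [HasFiniteCoproducts C]

/-- A total iteration operator on a monad: every Kleisli morphism `X ⟶ T (Y + X)` (all of them
count as guarded) is sent to a Kleisli morphism `X ⟶ T Y`. -/
abbrev IterOp (T : Monad C) : Type (max u v) :=
  ∀ ⦃X Y : C⦄, (X ⟶ T.obj (Y ⨿ X)) → (X ⟶ T.obj Y)

/-- `T`, equipped with the total iteration operator `it`, is a (complete) Elgot monad: `it` yields
solutions and satisfies the laws of iteration. -/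
structure IsElgot (T : Monad C) (it : IterOp T) : Prop where
  fixpoint : ∀ {X Y : C} (f : X ⟶ T.obj (Y ⨿ X)),
    it f = f ≫ klift T (coprod.desc (T.η.app Y) (it f))
  naturality : ∀ {X Y Z : C} (f : X ⟶ T.obj (Y ⨿ X)) (g : Y ⟶ T.obj Z),
    it f ≫ klift T g =
      it (f ≫ klift T (coprod.desc (g ≫ T.map coprod.inl) (coprod.inr ≫ T.η.app (Z ⨿ X))))
  codiagonal : ∀ {X Y : C} (f : X ⟶ T.obj ((Y ⨿ X) ⨿ X)),
    it (f ≫ T.map (coprod.desc (𝟙 (Y ⨿ X)) coprod.inr)) = it (it f)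
  uniformity : ∀ {X Y Z : C} (f : X ⟶ T.obj (Y ⨿ X)) (g : Z ⟶ T.obj (Y ⨿ Z)) (h : Z ⟶ X),
    h ≫ f = g ≫ T.map (coprod.map (𝟙 Y) h) → h ≫ it f = it g

/-- A parametrized monad `Q` (a functor into monads), equipped with a total iteration operator for
each parameter, is Elgot: each of its monads is Elgot, and the monad morphisms induced by morphisms
of parameters preserve iteration. -/
structure IsParamElgot {B : Type u'} [Category.{v'} B] (Q : B ⥤ Monad C)
    (it : ∀ b, IterOp (Q.obj b)) : Prop where
  elgot : ∀ b, IsElgot (Q.obj b) (it b)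
  preserves : ∀ {b b' : B} (p : b ⟶ b') {X Y : C} (f : X ⟶ (Q.obj b).obj (Y ⨿ X)),
    it b f ≫ (Q.map p).app Y = it b' (f ≫ (Q.map p).app (Y ⨿ X))

end Elgot

section Nu

variable {C : Type u} [Category.{v} C]

/-- The endofunctor `γ ↦ Y # γ` of a parametrized monad `#`, for fixed `Y`. -/
def stepFunctor (Q : C ⥤ Monad C) (Y : C) : C ⥤ C where
  obj γ := (Q.obj γ).obj Y
  map p := (Q.map p).app Y
  map_id γ := by rw [Q.map_id]; rfl
  map_comp p q := by rw [Q.map_comp]; rfl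

/-- A choice of final coalgebras `νγ. Y # γ`, for all `Y`. -/
structure FinalCoalgebras (Q : C ⥤ Monad C) where
  coalg : ∀ Y, Endofunctor.Coalgebra (stepFunctor Q Y)
  isTerminal : ∀ Y, IsTerminal (coalg Y)

variable {Q : C ⥤ Monad C} (N : FinalCoalgebras Q)

namespace FinalCoalgebras

/-- The object `νγ. Y # γ`. -/
def nu (Y : C) : C := (N.coalg Y).V

/-- The structure map of the final coalgebra. -/
def out (Y : C) : N.nu Y ⟶ (Q.obj (N.nu Y)).obj Y := (N.coalg Y).str

/-- Coiteration: the unique coalgebra morphism into the final coalgebra. -/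
def coit {W Y : C} (c : W ⟶ (Q.obj W).obj Y) : W ⟶ N.nu Y :=
  ((N.isTerminal Y).from (⟨W, c⟩ : Endofunctor.Coalgebra (stepFunctor Q Y))).f

theorem coit_out {W Y : C} (c : W ⟶ (Q.obj W).obj Y) :
    N.coit c ≫ N.out Y = c ≫ (Q.map (N.coit c)).app Y :=
  ((N.isTerminal Y).from (⟨W, c⟩ : Endofunctor.Coalgebra (stepFunctor Q Y))).h.symm

theorem coit_unique {W Y : C} (c : W ⟶ (Q.obj W).obj Y) (h : W ⟶ N.nu Y)
    (hh : h ≫ N.out Y = c ≫ (Q.map h).app Y) : h = N.coit c :=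
  congrArg Endofunctor.Coalgebra.Hom.f
    ((N.isTerminal Y).hom_ext
      (⟨h, hh.symm⟩ : (⟨W, c⟩ : Endofunctor.Coalgebra (stepFunctor Q Y)) ⟶ N.coalg Y)
      ((N.isTerminal Y).from (⟨W, c⟩ : Endofunctor.Coalgebra (stepFunctor Q Y))))

/-- The inverse of `out`. -/
def tuo (Y : C) : (Q.obj (N.nu Y)).obj Y ⟶ N.nu Y :=
  Endofunctor.Coalgebra.Terminal.strInv (N.isTerminal Y)

theorem out_tuo (Y : C) : N.out Y ≫ N.tuo Y = 𝟙 (N.nu Y) :=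
  Endofunctor.Coalgebra.Terminal.right_inv (N.isTerminal Y)

theorem tuo_out (Y : C) : N.tuo Y ≫ N.out Y = 𝟙 ((Q.obj (N.nu Y)).obj Y) :=
  Endofunctor.Coalgebra.Terminal.left_inv (N.isTerminal Y)

theorem out_cancel {W Y : C} {f g : W ⟶ N.nu Y} (h : f ≫ N.out Y = g ≫ N.out Y) : f = g := by
  have h' := congrArg (fun k => k ≫ N.tuo Y) h
  simpa [out_tuo] using h'

/-- The unit of the monad `Y ↦ νγ. Y # γ`, determined by `out ∘ unit = η`. -/
def nuUnit (Y : C) : Y ⟶ N.nu Y := (Q.obj (N.nu Y)).η.app Y ≫ N.tuo Y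

theorem nuUnit_out (Y : C) : N.nuUnit Y ≫ N.out Y = (Q.obj (N.nu Y)).η.app Y := by
  simp [nuUnit, tuo_out]

theorem map_app_comp {a b c : C} (p : a ⟶ b) (q : b ⟶ c) (Y : C) :
    (Q.map p).app Y ≫ (Q.map q).app Y = (Q.map (p ≫ q)).app Y := by
  rw [Q.map_comp]; rfl

theorem map_app_id (a Y : C) : (Q.map (𝟙 a)).app Y = 𝟙 ((Q.obj a).obj Y) := by
  rw [Q.map_id]; rfl

variable [HasFiniteCoproducts C]

/-- The coalgebra on `νγ. X # γ + νγ. Y # γ` used to define Kleisli lifting by primitive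
corecursion. -/
noncomputable def liftCoalg {X Y : C} (f : X ⟶ N.nu Y) :
    (N.nu X ⨿ N.nu Y) ⟶ (Q.obj (N.nu X ⨿ N.nu Y)).obj Y :=
  coprod.desc
    (N.out X ≫ (Q.map (coprod.inl : N.nu X ⟶ N.nu X ⨿ N.nu Y)).app X ≫
      klift (Q.obj (N.nu X ⨿ N.nu Y))
        (f ≫ N.out Y ≫ (Q.map (coprod.inr : N.nu Y ⟶ N.nu X ⨿ N.nu Y)).app Y))
    (N.out Y ≫ (Q.map (coprod.inr : N.nu Y ⟶ N.nu X ⨿ N.nu Y)).app Y)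

theorem inl_liftCoalg {X Y : C} (f : X ⟶ N.nu Y) :
    coprod.inl ≫ N.liftCoalg f =
      N.out X ≫ (Q.map (coprod.inl : N.nu X ⟶ N.nu X ⨿ N.nu Y)).app X ≫
        klift (Q.obj (N.nu X ⨿ N.nu Y))
          (f ≫ N.out Y ≫ (Q.map (coprod.inr : N.nu Y ⟶ N.nu X ⨿ N.nu Y)).app Y) :=
  coprod.inl_desc _ _

theorem inr_liftCoalg {X Y : C} (f : X ⟶ N.nu Y) :
    coprod.inr ≫ N.liftCoalg f =
      N.out Y ≫ (Q.map (coprod.inr : N.nu Y ⟶ N.nu X ⨿ N.nu Y)).app Y :=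
  coprod.inr_desc _ _

/-- Kleisli lifting of the monad `Y ↦ νγ. Y # γ`. -/
noncomputable def nuLift {X Y : C} (f : X ⟶ N.nu Y) : N.nu X ⟶ N.nu Y :=
  coprod.inl ≫ N.coit (N.liftCoalg f)


theorem inr_coit {X Y : C} (f : X ⟶ N.nu Y) :
    coprod.inr ≫ N.coit (N.liftCoalg f) = 𝟙 (N.nu Y) := by
  have h1 : coprod.inr ≫ N.coit (N.liftCoalg f) = N.coit (N.out Y) := by
    apply N.coit_unique
    rw [Category.assoc, coit_out, ← Category.assoc, inr_liftCoalg, Category.assoc, map_app_comp]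
  have h2 : 𝟙 (N.nu Y) = N.coit (N.out Y) := by
    apply N.coit_unique
    rw [map_app_id, Category.id_comp, Category.comp_id]
  rw [h1, h2]

theorem nuLift_out {X Y : C} (f : X ⟶ N.nu Y) :
    N.nuLift f ≫ N.out Y =
      N.out X ≫ (Q.map (N.nuLift f)).app X ≫ klift (Q.obj (N.nu Y)) (f ≫ N.out Y) := by
  rw [nuLift, Category.assoc, coit_out, ← Category.assoc, inl_liftCoalg]
  simp only [Category.assoc]
  rw [klift_monadHom, ← Category.assoc ((Q.map coprod.inl).app X), map_app_comp]
  simp only [Category.assoc]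
  rw [map_app_comp, inr_coit, map_app_id, Category.comp_id]

theorem nuLift_unique {X Y : C} (f : X ⟶ N.nu Y) (h : N.nu X ⟶ N.nu Y)
    (hh : h ≫ N.out Y =
      N.out X ≫ (Q.map h).app X ≫ klift (Q.obj (N.nu Y)) (f ≫ N.out Y)) :
    h = N.nuLift f := by
  have h1 : coprod.desc h (𝟙 (N.nu Y)) = N.coit (N.liftCoalg f) := by
    apply N.coit_unique
    apply coprod.hom_ext
    · rw [coprod.inl_desc_assoc, hh, ← Category.assoc coprod.inl, inl_liftCoalg]
      simp only [Category.assoc]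
      rw [klift_monadHom, ← Category.assoc ((Q.map coprod.inl).app X), map_app_comp]
      simp only [Category.assoc]
      rw [map_app_comp, coprod.inl_desc, coprod.inr_desc, map_app_id, Category.comp_id]
    · rw [coprod.inr_desc_assoc, ← Category.assoc coprod.inr, inr_liftCoalg, Category.assoc, map_app_comp,
        coprod.inr_desc, map_app_id, Category.comp_id, Category.id_comp]
  rw [nuLift, ← h1, coprod.inl_desc]

theorem nuLift_unit (X : C) : N.nuLift (N.nuUnit X) = 𝟙 (N.nu X) := by
  symm
  apply N.nuLift_unique
  rw [nuUnit_out, klift_unit, map_app_id, Category.id_comp, Category.comp_id, Category.comp_id]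

theorem nuUnit_lift {X Y : C} (f : X ⟶ N.nu Y) : N.nuUnit X ≫ N.nuLift f = f := by
  apply N.out_cancel
  rw [Category.assoc, nuLift_out, ← Category.assoc, nuUnit_out, ← Category.assoc]
  rw [(Q.map (N.nuLift f)).app_η, unit_klift]

theorem nuLift_lift {X Y Z : C} (f : X ⟶ N.nu Y) (g : Y ⟶ N.nu Z) :
    N.nuLift f ≫ N.nuLift g = N.nuLift (f ≫ N.nuLift g) := by
  apply N.nuLift_unique
  rw [Category.assoc, nuLift_out, ← Category.assoc, nuLift_out]
  simp only [Category.assoc]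
  rw [← Category.assoc (klift _ _), klift_monadHom]
  simp only [Category.assoc]
  rw [klift_klift, ← Category.assoc ((Q.map _).app _), map_app_comp, Category.assoc,
    Category.assoc, nuLift_out]

/-- The monad `Y ↦ νγ. Y # γ`. -/
noncomputable def nuMonad : Monad C :=
  monadOfKleisli N.nu N.nuUnit N.nuLift N.nuLift_unit N.nuUnit_lift N.nuLift_lift

/-- The iteration operator on `Y ↦ νγ. Y # γ` induced by iteration operators on the monads
`(-) # γ`: the operator sends `f : X ⟶ νγ. (Y + X) # γ` to
`coit ([η, (out ∘ f)†]^* ∘ out) ∘ unit ∘ inr`. -/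
noncomputable def nuIter (it : ∀ γ, IterOp (Q.obj γ)) : IterOp N.nuMonad :=
  fun X Y (f : X ⟶ N.nu (Y ⨿ X)) =>
    (coprod.inr : X ⟶ Y ⨿ X) ≫ N.nuUnit (Y ⨿ X) ≫
      N.coit (N.out (Y ⨿ X) ≫ klift (Q.obj (N.nu (Y ⨿ X)))
        (coprod.desc ((Q.obj (N.nu (Y ⨿ X))).η.app Y)
          (it (N.nu (Y ⨿ X)) (f ≫ N.out (Y ⨿ X)))))

end FinalCoalgebras
end Nu

section Resumptions

variable {C : Type u} [Category.{v} C] [HasFiniteCoproducts C]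

/-- Kleisli lifting of the monad `X ↦ T (X + E)`. -/
noncomputable def exceptionLift (T : Monad C) (E : C) {X Y : C} (f : X ⟶ T.obj (Y ⨿ E)) :
    T.obj (X ⨿ E) ⟶ T.obj (Y ⨿ E) :=
  klift T (coprod.desc f ((coprod.inr : E ⟶ Y ⨿ E) ≫ T.η.app (Y ⨿ E)))

theorem exceptionUnit_lift (T : Monad C) (E : C) {X Y : C} (f : X ⟶ T.obj (Y ⨿ E)) :
    (coprod.inl ≫ T.η.app (X ⨿ E)) ≫ exceptionLift T E f = f := by
  rw [exceptionLift, Category.assoc, unit_klift, coprod.inl_desc]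

theorem exceptionLift_lift (T : Monad C) (E : C) {X Y Z : C} (f : X ⟶ T.obj (Y ⨿ E))
    (g : Y ⟶ T.obj (Z ⨿ E)) :
    exceptionLift T E f ≫ exceptionLift T E g = exceptionLift T E (f ≫ exceptionLift T E g) := by
  rw [exceptionLift, exceptionLift, exceptionLift, klift_klift, coprod.desc_comp,
    Category.assoc, unit_klift, coprod.inr_desc]

/-- The monad `X ↦ T (X + E)`. -/
noncomputable def exceptionMonad (T : Monad C) (E : C) : Monad C :=
  monadOfKleisli (fun X => T.obj (X ⨿ E)) (fun X => coprod.inl ≫ T.η.app (X ⨿ E))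
    (exceptionLift T E)
    (fun X => by
      rw [exceptionLift, ← coprod.desc_comp, coprod.desc_inl_inr, Category.id_comp, klift_unit])
    (exceptionUnit_lift T E)
    (exceptionLift_lift T E)

theorem klift_exceptionMonad (T : Monad C) (E : C) {X Y : C} (f : X ⟶ T.obj (Y ⨿ E)) :
    klift (exceptionMonad T E) (Y := Y) f = exceptionLift T E f :=
  klift_monadOfKleisli _ _ _ _ (exceptionUnit_lift T E) (exceptionLift_lift T E) _

theorem exceptionLift_map (T : Monad C) {E E' : C} (e : E ⟶ E') {X Y : C}
    (f : X ⟶ T.obj (Y ⨿ E)) :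
    exceptionLift T E f ≫ T.map (coprod.map (𝟙 Y) e) =
      T.map (coprod.map (𝟙 X) e) ≫ exceptionLift T E' (f ≫ T.map (coprod.map (𝟙 Y) e)) := by
  rw [exceptionLift, exceptionLift, map_eq_klift T, map_eq_klift T, klift_klift, klift_klift]
  congr 1
  apply coprod.hom_ext <;> simp [unit_klift]

/-- The monad morphism `T (- + E) ⟶ T (- + E')` induced by `e : E ⟶ E'`. -/
noncomputable def exceptionMap (T : Monad C) {E E' : C} (e : E ⟶ E') :
    exceptionMonad T E ⟶ exceptionMonad T E' :=
  monadHomOfKleisli (S := exceptionMonad T E) (T := exceptionMonad T E')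
    (fun X => T.map (coprod.map (𝟙 X) e))
    (fun X => by
      change (coprod.inl ≫ T.η.app (X ⨿ E)) ≫ T.map (coprod.map (𝟙 X) e) =
        coprod.inl ≫ T.η.app (X ⨿ E')
      have h := T.η.naturality (coprod.map (𝟙 X) e)
      simp only [Functor.id_map] at h
      rw [Category.assoc, ← h, coprod.inl_map_assoc, Category.id_comp])
    (fun {X Y} f => by
      exact (congrArg (fun k => k ≫ T.map (coprod.map (𝟙 Y) e))
          (klift_exceptionMonad T E (Y := Y) f)).trans
        ((exceptionLift_map T e (X := X) (Y := Y) f).trans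
          (congrArg (fun k => T.map (coprod.map (𝟙 X) e) ≫ k)
            (klift_exceptionMonad T E' (Y := Y) (f ≫ T.map (coprod.map (𝟙 Y) e))).symm)))

/-- The parametrized monad `X # γ = T (X + Σ γ)`. -/
noncomputable def resumptionParam (T : Monad C) (S : C ⥤ C) : C ⥤ Monad C where
  obj γ := exceptionMonad T (S.obj γ)
  map p := exceptionMap T (S.map p)
  map_id γ := by
    apply MonadHom.ext
    funext X
    change T.map (coprod.map (𝟙 X) (S.map (𝟙 γ))) = 𝟙 (T.obj (X ⨿ S.obj γ))
    simp
  map_comp p q := by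
    apply MonadHom.ext
    funext X
    change T.map (coprod.map (𝟙 X) (S.map (p ≫ q))) =
      T.map (coprod.map (𝟙 X) (S.map p)) ≫ T.map (coprod.map (𝟙 X) (S.map q))
    rw [← T.map_comp, coprod.map_map, S.map_comp, Category.comp_id]

/-- The iteration operators on the monads `T (- + Σ γ)` induced by one on `T`:
`f : X ⟶ T ((Y + X) + Σ γ)` is rearranged to `X ⟶ T ((Y + Σ γ) + X)` and then iterated. -/
noncomputable def resumptionIter (T : Monad C) (S : C ⥤ C) (it : IterOp T) :
    ∀ γ, IterOp ((resumptionParam T S).obj γ) :=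
  fun γ X Y (f : X ⟶ T.obj ((Y ⨿ X) ⨿ S.obj γ)) =>
    it (X := X) (Y := Y ⨿ S.obj γ)
      (f ≫ T.map (coprod.desc (coprod.map coprod.inl (𝟙 X)) (coprod.inr ≫ coprod.inl)))

end Resumptions

end GuardedIteration

/-!
Iteration on `νγ. Y # γ` is reduced to iteration on the monads `(-) # γ` by a characterization of
the former: for `f : X ⟶ νγ. (Y + X) # γ`, the morphism `f‡` given by `nuIter` is the unique
`g : X ⟶ νγ. Y # γ` with

  `out ∘ g = ((id # [unit, g]^*) ∘ out ∘ f)†`,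

the iteration on the right being that of the monad `(-) # (νγ. Y # γ)`. Indeed, since the monad
morphisms `id # p` preserve iteration, this equation says exactly that the Kleisli lifting
`[unit, g]^*` is the coalgebra morphism `coit ([η, (out ∘ f)†]^* ∘ out)`
(`nuSol_out` and `nuSol_unique`). Each law for `‡` then follows by checking
that the candidate solves the equation, which uses the same law for `†`, the formula
`nuLift_out` for `out` after a Kleisli lifting, and, for the codiagonal law, the fixpoint law
already proved for `‡`.

For resumptions it remains to see that `X # γ = T (X + Σ γ)` is an Elgot parametrized monad. Up to
the rearrangement of summands, iteration there is iteration of `T` with the extra summand `Σ γ`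
treated as part of the output, so each law is an instance of the same law for `T`, combined with
naturality along morphisms of `C` to move the rearrangements past the iteration operator.
-/

namespace GuardedIteration

/-! ### Kleisli lifting and iteration along plain morphisms -/

section Kleisli

variable {C : Type u} [Category.{v} C]

theorem map_klift (T : Monad C) {X Y Z : C} (k : X ⟶ Y) (f : Y ⟶ T.obj Z) :
    T.map k ≫ klift T f = klift T (k ≫ f) := by
  simp [klift]

theorem klift_map (T : Monad C) {X Y Z : C} (f : X ⟶ T.obj Y) (k : Y ⟶ Z) :
    klift T f ≫ T.map k = klift T (f ≫ T.map k) := by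
  rw [map_eq_klift, klift_klift]

theorem unit_map (T : Monad C) {X Y : C} (k : X ⟶ Y) :
    T.η.app X ≫ T.map k = k ≫ T.η.app Y := by
  rw [map_eq_klift, unit_klift]

variable [HasFiniteCoproducts C]

/-- Naturality along a morphism of `C`. -/
theorem IsElgot.naturality_map {T : Monad C} {it : IterOp T} (h : IsElgot T it) {X Y Z : C}
    (f : X ⟶ T.obj (Y ⨿ X)) (k : Y ⟶ Z) :
    it f ≫ T.map k = it (f ≫ T.map (coprod.map k (𝟙 X))) := by
  rw [map_eq_klift, h.naturality, map_eq_klift T (coprod.map k (𝟙 X))]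
  congr 3
  apply coprod.hom_ext <;> simp [coprod.inl_desc, coprod.inr_desc, unit_map]

end Kleisli

/-! ### Iteration on `νγ. Y # γ` -/

namespace FinalCoalgebras

variable {C : Type u} [Category.{v} C] {Q : C ⥤ Monad C} (N : FinalCoalgebras Q)
variable [HasFiniteCoproducts C]

theorem klift_nuMonad {X Y : C} (f : X ⟶ N.nu Y) :
    klift N.nuMonad (Y := Y) f = N.nuLift f :=
  klift_monadOfKleisli N.nu N.nuUnit N.nuLift N.nuLift_unit N.nuUnit_lift N.nuLift_lift f

/-- The functorial action of `Y ↦ νγ. Y # γ`. -/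
noncomputable def nuMap {X Y : C} (k : X ⟶ Y) : N.nu X ⟶ N.nu Y :=
  N.nuLift (k ≫ N.nuUnit Y)

theorem nuMap_nuLift {X Y Z : C} (k : X ⟶ Y) (f : Y ⟶ N.nu Z) :
    N.nuMap k ≫ N.nuLift f = N.nuLift (k ≫ f) := by
  rw [nuMap, nuLift_lift, Category.assoc, nuUnit_lift]

/-- The form of `nuLift_out` in which a further parameter morphism `q` is absorbed, so that it
rewrites under the right-hand side of the equation characterizing iteration. -/
theorem nuLift_out_app {X Y B : C} (f : X ⟶ N.nu Y) (q : N.nu Y ⟶ B) :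
    N.nuLift f ≫ N.out Y ≫ (Q.map q).app Y =
      N.out X ≫ (Q.map (N.nuLift f ≫ q)).app X ≫
        klift (Q.obj B) (f ≫ N.out Y ≫ (Q.map q).app Y) := by
  rw [← Category.assoc, nuLift_out]
  simp only [Category.assoc]
  rw [klift_monadHom, ← Category.assoc ((Q.map _).app _), map_app_comp, Category.assoc]

theorem nuMap_out_app {X Y B : C} (k : X ⟶ Y) (q : N.nu Y ⟶ B) :
    N.nuMap k ≫ N.out Y ≫ (Q.map q).app Y =
      N.out X ≫ (Q.map (N.nuMap k ≫ q)).app X ≫ (Q.obj B).map k := by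
  rw [nuMap, nuLift_out_app, Category.assoc, ← Category.assoc (N.nuUnit Y), nuUnit_out,
    (Q.map q).app_η, map_eq_klift]

variable {N} {it : ∀ γ, IterOp (Q.obj γ)}

/-- The iteration `f‡` given by `nuIter`, typed as a morphism into `N.nu Y` rather than into the
definitionally equal `N.nuMonad.obj Y`. -/
noncomputable def nuSol (N : FinalCoalgebras Q) (it : ∀ γ, IterOp (Q.obj γ)) {X Y : C}
    (f : X ⟶ N.nu (Y ⨿ X)) : X ⟶ N.nu Y :=
  N.nuIter it f

/-- The Kleisli lifting of `[unit, g]` is the coiteration defining `f‡` as soon as `g` solves the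
characteristic equation. -/
theorem nuLift_eq_coit (hQ : IsParamElgot Q it) {X Y : C} (f : X ⟶ N.nu (Y ⨿ X))
    (g : X ⟶ N.nu Y)
    (hg : g ≫ N.out Y = it (N.nu Y)
      (f ≫ N.out (Y ⨿ X) ≫ (Q.map (N.nuLift (coprod.desc (N.nuUnit Y) g))).app (Y ⨿ X))) :
    N.nuLift (coprod.desc (N.nuUnit Y) g) =
      N.coit (N.out (Y ⨿ X) ≫ klift (Q.obj (N.nu (Y ⨿ X)))
        (coprod.desc ((Q.obj (N.nu (Y ⨿ X))).η.app Y)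
          (it (N.nu (Y ⨿ X)) (f ≫ N.out (Y ⨿ X))))) := by
  apply N.coit_unique
  rw [nuLift_out, Category.assoc, klift_monadHom, coprod.desc_comp, coprod.desc_comp, nuUnit_out,
    hg, (Q.map _).app_η, hQ.preserves, Category.assoc]

/-- Uniqueness half of the characterization of `f‡`. -/
theorem nuSol_unique (hQ : IsParamElgot Q it) {X Y : C} (f : X ⟶ N.nu (Y ⨿ X))
    (g : X ⟶ N.nu Y)
    (hg : g ≫ N.out Y = it (N.nu Y)
      (f ≫ N.out (Y ⨿ X) ≫ (Q.map (N.nuLift (coprod.desc (N.nuUnit Y) g))).app (Y ⨿ X))) :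
    g = N.nuSol it f := by
  have h : N.nuSol it f = coprod.inr ≫ N.nuUnit (Y ⨿ X) ≫ N.coit _ := rfl
  rw [h, ← nuLift_eq_coit hQ f g hg, nuUnit_lift, coprod.inr_desc]

/-- Existence half of the characterization of `f‡`: it solves the characteristic equation, because
the coiteration in its definition is itself the Kleisli lifting of `[unit, f‡]`. -/
theorem nuSol_out (hQ : IsParamElgot Q it) {X Y : C} (f : X ⟶ N.nu (Y ⨿ X)) :
    N.nuSol it f ≫ N.out Y = it (N.nu Y)
      (f ≫ N.out (Y ⨿ X) ≫
        (Q.map (N.nuLift (coprod.desc (N.nuUnit Y) (N.nuSol it f)))).app (Y ⨿ X)) := by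
  set c := N.out (Y ⨿ X) ≫ klift (Q.obj (N.nu (Y ⨿ X)))
        (coprod.desc ((Q.obj (N.nu (Y ⨿ X))).η.app Y)
          (it (N.nu (Y ⨿ X)) (f ≫ N.out (Y ⨿ X)))) with hc
  have hs : N.nuSol it f = coprod.inr ≫ N.nuUnit (Y ⨿ X) ≫ N.coit c := rfl
  have hcoit : N.coit c ≫ N.out Y = N.out (Y ⨿ X) ≫ (Q.map (N.coit c)).app (Y ⨿ X) ≫
      klift (Q.obj (N.nu Y)) (coprod.desc ((Q.obj (N.nu Y)).η.app Y)
        (it (N.nu Y) (f ≫ N.out (Y ⨿ X) ≫ (Q.map (N.coit c)).app (Y ⨿ X)))) := by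
    rw [coit_out, hc, Category.assoc, klift_monadHom, coprod.desc_comp, (Q.map _).app_η,
      hQ.preserves, Category.assoc]
  have hunit : N.nuUnit (Y ⨿ X) ≫ N.coit c ≫ N.out Y =
      coprod.desc ((Q.obj (N.nu Y)).η.app Y)
        (it (N.nu Y) (f ≫ N.out (Y ⨿ X) ≫ (Q.map (N.coit c)).app (Y ⨿ X))) := by
    rw [hcoit, ← Category.assoc, nuUnit_out, ← Category.assoc, (Q.map _).app_η, unit_klift]
    rfl
  have hout : N.nuSol it f ≫ N.out Y =
      it (N.nu Y) (f ≫ N.out (Y ⨿ X) ≫ (Q.map (N.coit c)).app (Y ⨿ X)) := by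
    rw [hs, Category.assoc, Category.assoc, hunit, coprod.inr_desc]
  have hlift : N.coit c = N.nuLift (coprod.desc (N.nuUnit Y) (N.nuSol it f)) := by
    apply N.nuLift_unique
    rw [hcoit, coprod.desc_comp, nuUnit_out, hout]
  rw [← hlift, hout]

theorem nuSol_fixpoint (hQ : IsParamElgot Q it) {X Y : C} (f : X ⟶ N.nu (Y ⨿ X)) :
    N.nuSol it f = f ≫ N.nuLift (coprod.desc (N.nuUnit Y) (N.nuSol it f)) := by
  apply N.out_cancel
  rw [Category.assoc, nuLift_out, coprod.desc_comp, nuUnit_out, nuSol_out hQ f]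
  conv_lhs => rw [(hQ.elgot _).fixpoint]
  simp only [Category.assoc]

theorem nuSol_naturality (hQ : IsParamElgot Q it) {X Y Z : C} (f : X ⟶ N.nu (Y ⨿ X))
    (g : Y ⟶ N.nu Z) :
    N.nuSol it f ≫ N.nuLift g =
      N.nuSol it (f ≫ N.nuLift
        (coprod.desc (g ≫ N.nuMap coprod.inl) (coprod.inr ≫ N.nuUnit (Z ⨿ X)))) := by
  apply nuSol_unique hQ
  set k := N.nuSol it f ≫ N.nuLift g with hk
  have hl : N.nuLift (coprod.desc (N.nuUnit Y) (N.nuSol it f)) ≫ N.nuLift g =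
      N.nuLift (coprod.desc g k) := by
    rw [nuLift_lift, coprod.desc_comp, nuUnit_lift]
  have hr : N.nuLift (coprod.desc (g ≫ N.nuMap coprod.inl) (coprod.inr ≫ N.nuUnit (Z ⨿ X))) ≫
      N.nuLift (coprod.desc (N.nuUnit Z) k) = N.nuLift (coprod.desc g k) := by
    rw [nuLift_lift, coprod.desc_comp, Category.assoc, Category.assoc, nuUnit_lift,
      nuMap_nuLift, coprod.inl_desc, coprod.inr_desc, nuLift_unit, Category.comp_id]
  have hi : N.nuMap (coprod.inl : Z ⟶ Z ⨿ X) ≫ N.nuLift (coprod.desc (N.nuUnit Z) k) =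
      𝟙 (N.nu Z) := by
    rw [nuMap_nuLift, coprod.inl_desc, nuLift_unit]
  rw [Category.assoc f, nuLift_out_app, hr, coprod.desc_comp, Category.assoc g, nuMap_out_app, hi,
    map_app_id, Category.id_comp, Category.assoc coprod.inr, ← Category.assoc (N.nuUnit _),
    nuUnit_out, (Q.map _).app_η, hk, Category.assoc, nuLift_out, ← Category.assoc,
    nuSol_out hQ f, ← Category.assoc, hQ.preserves, (hQ.elgot _).naturality]
  simp only [Category.assoc]
  rw [← Category.assoc ((Q.map _).app _), map_app_comp, hl]

theorem nuSol_codiagonal (hQ : IsParamElgot Q it) {X Y : C} (f : X ⟶ N.nu ((Y ⨿ X) ⨿ X)) :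
    N.nuSol it (f ≫ N.nuMap (coprod.desc (𝟙 (Y ⨿ X)) coprod.inr)) =
      N.nuSol it (N.nuSol it f) := by
  symm
  apply nuSol_unique hQ
  set e := N.nuSol it f with he
  set g := N.nuSol it e with hg
  -- The fixpoint law for `e` identifies the parameter morphisms on the two sides.
  have hl : N.nuLift (coprod.desc (N.nuUnit (Y ⨿ X)) e) ≫
      N.nuLift (coprod.desc (N.nuUnit Y) g) =
      N.nuMap (coprod.desc (𝟙 (Y ⨿ X)) coprod.inr) ≫ N.nuLift (coprod.desc (N.nuUnit Y) g) := by
    rw [nuLift_lift, nuMap_nuLift, coprod.desc_comp, coprod.desc_comp, nuUnit_lift,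
      Category.id_comp, coprod.inr_desc, ← nuSol_fixpoint hQ e]
  rw [Category.assoc f, nuMap_out_app, hg, nuSol_out hQ e, ← hg, ← Category.assoc e, he,
    nuSol_out hQ f, ← he, hQ.preserves, ← (hQ.elgot _).codiagonal]
  simp only [Category.assoc]
  rw [← Category.assoc ((Q.map _).app _), map_app_comp, hl]

theorem nuSol_uniformity (hQ : IsParamElgot Q it) {X Y Z : C} (f : X ⟶ N.nu (Y ⨿ X))
    (g : Z ⟶ N.nu (Y ⨿ Z)) (h : Z ⟶ X) (hh : h ≫ f = g ≫ N.nuMap (coprod.map (𝟙 Y) h)) :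
    h ≫ N.nuSol it f = N.nuSol it g := by
  apply nuSol_unique hQ
  rw [Category.assoc, nuSol_out hQ f]
  apply (hQ.elgot _).uniformity
  rw [← Category.assoc h, hh, Category.assoc, nuMap_out_app, nuMap_nuLift, coprod.map_desc,
    Category.id_comp]
  simp only [Category.assoc]

variable (N) in
theorem isElgot_nuMonad (hQ : IsParamElgot Q it) : IsElgot N.nuMonad (N.nuIter it) where
  -- The laws of `nuSol` are those of `nuIter` up to unfolding `nuMonad`, except that `klift` has to
  -- be identified with `nuLift`; `congrArg` does so across the two typings.
  fixpoint f := (nuSol_fixpoint (N := N) hQ f).trans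
    (congrArg (fun k => f ≫ k) (N.klift_nuMonad _).symm)
  naturality {X Y Z} f g :=
    (congrArg (fun k => N.nuSol it f ≫ k) (N.klift_nuMonad g)).trans
      ((nuSol_naturality (N := N) hQ f g).trans
        (congrArg (fun k : N.nu (Y ⨿ X) ⟶ N.nu (Z ⨿ X) => N.nuSol it (f ≫ k))
          (N.klift_nuMonad _).symm))
  codiagonal f := nuSol_codiagonal (N := N) hQ f
  uniformity f g h hh := nuSol_uniformity (N := N) hQ f g h hh

end FinalCoalgebras

/-! ### Iteration on `T (X + Σ γ)` -/

section Resumptions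

variable {C : Type u} [Category.{v} C] [HasFiniteCoproducts C]

/-- The rearrangement `(Y + X) + E ⟶ (Y + E) + X`. It is spelled as in `resumptionIter`, so that
`exceptionIter` unfolds to it. -/
noncomputable def swapLast (Y X E : C) : (Y ⨿ X) ⨿ E ⟶ (Y ⨿ E) ⨿ X :=
  coprod.desc (coprod.map coprod.inl (𝟙 X)) (coprod.inr ≫ coprod.inl)

/-- Iteration on `X ↦ T (X + E)`: the summand `E` is moved into the output, then `T` iterates.
Morphisms are typed by `T`, not by the definitionally equal `exceptionMonad T E`. -/
noncomputable def exceptionIter {T : Monad C} (it : IterOp T) {E X Y : C}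
    (f : X ⟶ T.obj ((Y ⨿ X) ⨿ E)) : X ⟶ T.obj (Y ⨿ E) :=
  it (f ≫ T.map (swapLast Y X E))

theorem map_exceptionMonad (T : Monad C) (E : C) {X Y : C} (k : X ⟶ Y) :
    (exceptionMonad T E).map k = T.map (coprod.map k (𝟙 E)) := by
  change exceptionLift T E (k ≫ coprod.inl ≫ T.η.app (Y ⨿ E)) = _
  rw [exceptionLift, map_eq_klift]
  congr 1
  apply coprod.hom_ext <;> simp [coprod.inl_desc, coprod.inr_desc]

theorem exceptionIter_fixpoint {T : Monad C} {it : IterOp T} (h : IsElgot T it) {E X Y : C}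
    (f : X ⟶ T.obj ((Y ⨿ X) ⨿ E)) :
    exceptionIter it f =
      f ≫ exceptionLift T E (coprod.desc (coprod.inl ≫ T.η.app (Y ⨿ E)) (exceptionIter it f)) := by
  conv_lhs => rw [exceptionIter, h.fixpoint, Category.assoc, map_klift]
  rw [exceptionLift]
  congr 2
  apply coprod.hom_ext
  · apply coprod.hom_ext <;> simp [coprod.inl_desc, coprod.inr_desc, swapLast, exceptionIter]
  · simp [coprod.inl_desc, coprod.inr_desc, swapLast]

theorem exceptionIter_naturality {T : Monad C} {it : IterOp T} (h : IsElgot T it) {E X Y Z : C}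
    (f : X ⟶ T.obj ((Y ⨿ X) ⨿ E)) (g : Y ⟶ T.obj (Z ⨿ E)) :
    exceptionIter it f ≫ exceptionLift T E g =
      exceptionIter it (f ≫ exceptionLift T E
        (coprod.desc (g ≫ T.map (coprod.map coprod.inl (𝟙 E)))
          (coprod.inr ≫ coprod.inl ≫ T.η.app ((Z ⨿ X) ⨿ E)))) := by
  rw [exceptionIter, exceptionIter, exceptionLift, exceptionLift, h.naturality]
  simp only [Category.assoc]
  rw [map_klift, klift_map]
  congr 3
  apply coprod.hom_ext
  · apply coprod.hom_ext
    · simp only [swapLast, coprod.inl_desc_assoc, coprod.inl_map_assoc, coprod.inl_desc,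
        Category.assoc, ← T.map_comp]
      congr 2
      apply coprod.hom_ext <;> simp [coprod.inl_desc, coprod.inr_desc]
    · simp [coprod.inl_desc, coprod.inr_desc, swapLast, unit_map]
  · simp [coprod.inl_desc, coprod.inr_desc, swapLast, unit_map]

theorem exceptionIter_codiagonal {T : Monad C} {it : IterOp T} (h : IsElgot T it) {E X Y : C}
    (f : X ⟶ T.obj (((Y ⨿ X) ⨿ X) ⨿ E)) :
    exceptionIter it
        (f ≫ T.map (coprod.map (coprod.desc (𝟙 (Y ⨿ X)) coprod.inr) (𝟙 E))) =
      exceptionIter it (exceptionIter it f) := by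
  rw [exceptionIter, exceptionIter, exceptionIter, h.naturality_map, ← h.codiagonal]
  simp only [Category.assoc, ← T.map_comp]
  congr 3
  apply coprod.hom_ext
  · apply coprod.hom_ext
    · apply coprod.hom_ext <;> simp [coprod.inl_desc, coprod.inr_desc, swapLast]
    · simp [coprod.inl_desc, coprod.inr_desc, swapLast]
  · simp [coprod.inl_desc, coprod.inr_desc, swapLast]

theorem exceptionIter_uniformity {T : Monad C} {it : IterOp T} (h : IsElgot T it) {E X Y Z : C}
    (f : X ⟶ T.obj ((Y ⨿ X) ⨿ E)) (g : Z ⟶ T.obj ((Y ⨿ Z) ⨿ E)) (k : Z ⟶ X)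
    (hk : k ≫ f = g ≫ T.map (coprod.map (coprod.map (𝟙 Y) k) (𝟙 E))) :
    k ≫ exceptionIter it f = exceptionIter it g := by
  apply h.uniformity
  rw [← Category.assoc, hk]
  simp only [Category.assoc, ← T.map_comp]
  congr 2
  apply coprod.hom_ext
  · apply coprod.hom_ext <;> simp [coprod.inl_desc, swapLast]
  · simp [coprod.inr_desc, swapLast]

/-- The monad morphisms `T (- + E) ⟶ T (- + E')` preserve iteration. This is naturality of iteration
of `T`, since `E` belongs to the output. -/
theorem exceptionIter_map {T : Monad C} {it : IterOp T} (h : IsElgot T it) {E E' X Y : C}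
    (f : X ⟶ T.obj ((Y ⨿ X) ⨿ E)) (e : E ⟶ E') :
    exceptionIter it f ≫ T.map (coprod.map (𝟙 Y) e) =
      exceptionIter it (f ≫ T.map (coprod.map (𝟙 (Y ⨿ X)) e)) := by
  rw [exceptionIter, exceptionIter, h.naturality_map]
  simp only [Category.assoc, ← T.map_comp]
  congr 3
  apply coprod.hom_ext
  · apply coprod.hom_ext <;> simp [coprod.inl_desc, swapLast]
  · simp [coprod.inr_desc, swapLast]

theorem isElgot_exceptionMonad {T : Monad C} {it : IterOp T} (h : IsElgot T it) (E : C) :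
    IsElgot (exceptionMonad T E) (fun _ _ f => exceptionIter it f) where
  fixpoint {X Y} f := (exceptionIter_fixpoint h f).trans
    (congrArg (fun k => f ≫ k) (klift_exceptionMonad T E _).symm)
  naturality {X Y Z} f g := by
    refine (congrArg (fun k => exceptionIter it f ≫ k) (klift_exceptionMonad T E g)).trans
      ((exceptionIter_naturality h f g).trans ?_)
    refine congrArg (fun k : T.obj ((Y ⨿ X) ⨿ E) ⟶ T.obj ((Z ⨿ X) ⨿ E) =>
      exceptionIter it (f ≫ k)) ?_
    rw [← map_exceptionMonad]
    exact (klift_exceptionMonad T E _).symm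
  codiagonal {X Y} f :=
    (congrArg (fun k : T.obj (((Y ⨿ X) ⨿ X) ⨿ E) ⟶ T.obj ((Y ⨿ X) ⨿ E) =>
      exceptionIter it (f ≫ k)) (map_exceptionMonad T E _)).trans
      (exceptionIter_codiagonal h f)
  uniformity {X Y Z} f g k hk := exceptionIter_uniformity h f g k
    (hk.trans (congrArg (fun l => g ≫ l) (map_exceptionMonad T E _)))

theorem isParamElgot_resumptionParam {T : Monad C} {it : IterOp T} (h : IsElgot T it)
    (S : C ⥤ C) : IsParamElgot (resumptionParam T S) (resumptionIter T S it) where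
  elgot γ := isElgot_exceptionMonad h (S.obj γ)
  preserves p _ _ f := exceptionIter_map h f (S.map p)

end Resumptions

end GuardedIteration

theorem corollary5p10 {C : Type u} [Category.{v} C] [HasFiniteCoproducts C]
    {D : Type u'} [Category.{v'} D] :
    (∀ (P : C × D ⥤ Monad C) (X : D)
        (N : GuardedIteration.FinalCoalgebras (Prod.sectL C X ⋙ P))
        (it : ∀ γ : C, GuardedIteration.IterOp ((Prod.sectL C X ⋙ P).obj γ)),
        GuardedIteration.IsParamElgot (Prod.sectL C X ⋙ P) it →
          GuardedIteration.IsElgot N.nuMonad (N.nuIter it)) ∧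
    (∀ (T : Monad C) (S : C ⥤ C)
        (N : GuardedIteration.FinalCoalgebras (GuardedIteration.resumptionParam T S))
        (it : GuardedIteration.IterOp T),
        GuardedIteration.IsElgot T it →
          GuardedIteration.IsElgot N.nuMonad
            (N.nuIter (GuardedIteration.resumptionIter T S it))) :=
  ⟨fun _ _ N _ hQ => N.isElgot_nuMonad hQ,
    fun _ S N _ h => N.isElgot_nuMonad (GuardedIteration.isParamElgot_resumptionParam h S)⟩
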